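/- Let $\mathbb K\in\{\mathbb R,\mathbb C\}$, let $K$ be a compact Hausdorff space, and let $A\subseteq C(K,\mathbb K)$ be a uniform algebra, that is, a subalgebra that is closed in the supremum norm, contains the constant functions and separates the points of $K$. If $A$ is infinite-dimensional, then $A$ has the strong diameter 2 property: for all $n\ge 1$, all $\lambda_1,\dots,\lambda_n\ge 0$ with $\sum_{i=1}^n\lambda_i=1$, all functionals $f_1,\dots,f_n\in A^*$ of norm $1$ and all $\varepsilon_1,\dots,\varepsilon_n>0$, the convex combination of slices $$\sum_{i=1}^n\lambda_i S(f_i,\varepsilon_i)=\Big\{\sum_{i=1}^n\lambda_i x_i : x_i\in S(f_i,\varepsilon_i)\Big\},\qquad S(f,\varepsilon)=\{x\in A:\|x\|\le 1,\ \operatorname{Re} f(x)>1-\varepsilon\},$$ has diameter exactly $2$. -/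

import Mathlib

/-- A uniform algebra on a compact Hausdorff space `K`: a subalgebra of `C(K, 𝕜)` (a `Subalgebra`
contains the constants) that is closed in the supremum norm and separates the points of `K`. -/
structure IsUniformAlgebra {𝕜 : Type*} [RCLike 𝕜] {K : Type*} [TopologicalSpace K]
    [CompactSpace K] [T2Space K] (A : Subalgebra 𝕜 C(K, 𝕜)) : Prop where
  isClosed : IsClosed (A : Set C(K, 𝕜))
  separatesPoints : A.SeparatesPoints

/-- The slice `{x ∈ B_X : Re f x > 1 - ε}` of the closed unit ball. Over `ℝ` the real part is the
identity; over `ℂ` the map `f ↦ Re f` is an isometric bijection onto the continuous real-linear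
functionals, so these are the slices of the unit ball of the underlying real space. -/
def unitBallSlice {𝕜 : Type*} [RCLike 𝕜] {X : Type*} [NormedAddCommGroup X] [NormedSpace 𝕜 X]
    (f : X →L[𝕜] 𝕜) (ε : ℝ) : Set X :=
  {x | ‖x‖ ≤ 1 ∧ 1 - ε < RCLike.re (f x)}

/-- The set `∑ i, c i • S i` of all `∑ i, c i • x i` with `x i ∈ S i`. -/
def weightedSetSum (𝕜 : Type*) [RCLike 𝕜] {X : Type*} [NormedAddCommGroup X] [NormedSpace 𝕜 X]
    {n : ℕ} (c : Fin n → ℝ) (S : Fin n → Set X) : Set X :=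
  {y | ∃ x : Fin n → X, (∀ i, x i ∈ S i) ∧ y = ∑ i, (c i : 𝕜) • x i}

/-- Every finite convex combination of slices of the unit ball has diameter 2. -/
def HasStrongDiameterTwoProperty (𝕜 : Type*) [RCLike 𝕜] (X : Type*) [NormedAddCommGroup X]
    [NormedSpace 𝕜 X] : Prop :=
  ∀ (n : ℕ) (c : Fin n → ℝ) (f : Fin n → (X →L[𝕜] 𝕜)) (ε : Fin n → ℝ),
    (∀ i, 0 ≤ c i) → ∑ i, c i = 1 → (∀ i, ‖f i‖ = 1) → (∀ i, 0 < ε i) →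
      Metric.diam (weightedSetSum 𝕜 c (fun i => unitBallSlice (f i) (ε i))) = 2

/-!
The proof splits into a geometric part, which produces peaking elements of `A`, and a
functional-analytic part, which uses them to perturb points of the slices.

Among the closed subsets of `K` on which every element of `A` attains its norm choose a minimal
one, `B`. By minimality, every open set meeting `B` carries the peak of an element of norm one which
is small on the rest of `B` (`IsNormAttainingSet.exists_peak`). Averaging `m` such elements, each
peaking where the preceding ones are almost `1`, gives elements `p` for which `|p| + |1 - p|` is at
most `1 + δ` on `B`, so that the values of `p` lie in a thin ellipse around `[0, 1]`
(`IsNormAttainingSet.exists_thin_peak`). This plays the role of composing a peak function with a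
conformal map onto a thin region, but uses only sums, and it works over `ℝ` and `ℂ` alike.

As `A` is infinite-dimensional, `B` is infinite, hence contains a sequence of disjoint nonempty
relatively open sets. Thin peaks `p j` over them have uniformly bounded sums `∑ j, |p j|` on `B`, so
`f (x * p j) → 0` for every functional `f` and every `x` in `A`
(`IsNormAttainingSet.tendsto_apply_zero`); no representing measures are needed. If `x i` lies in the
`i`-th slice, then so do `(1 + δ)⁻¹ • (x i * (1 - p j) ± p j)` for small `δ` and large `j`, and the
two corresponding convex combinations differ by `2 * (1 + δ)⁻¹ • p j`, whose norm is close to `2`.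
-/

open Filter Topology

section NormAttaining

variable {𝕜 : Type*} [RCLike 𝕜] {K : Type*} [TopologicalSpace K] [CompactSpace K]
  {A : Subalgebra 𝕜 C(K, 𝕜)} {B : Set K}

/-- `B` is a closed boundary for `A`: a closed set on which every element of `A` attains its
supremum norm. -/
structure IsNormAttainingSet (A : Subalgebra 𝕜 C(K, 𝕜)) (B : Set K) : Prop where
  isClosed : IsClosed B
  exists_norm_eq : ∀ a ∈ A, ∃ b ∈ B, ‖a b‖ = ‖a‖

/-! ### Minimal boundaries -/

/-- The intersection of a chain of boundaries is a boundary by compactness, so Zorn's lemma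
applies. -/
theorem exists_minimal_isNormAttainingSet [Nonempty K] (A : Subalgebra 𝕜 C(K, 𝕜)) :
    ∃ B, Minimal (IsNormAttainingSet A) B := by
  refine zorn_superset {B | IsNormAttainingSet A B} fun c hc hchain => ?_
  rcases c.eq_empty_or_nonempty with rfl | hne
  · refine ⟨Set.univ, ⟨isClosed_univ, fun a _ => ?_⟩, by simp⟩
    obtain ⟨b, -, hb⟩ := isCompact_univ.exists_isMaxOn Set.univ_nonempty
      (f := fun t => ‖a t‖) (by fun_prop)
    refine ⟨b, trivial, le_antisymm (a.norm_coe_le_norm b) ?_⟩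
    exact (ContinuousMap.norm_le _ (norm_nonneg _)).2 fun t => hb (Set.mem_univ t)
  refine ⟨⋂₀ c, ⟨isClosed_sInter fun s hs => (hc hs).isClosed, fun a ha => ?_⟩,
    fun s hs => Set.sInter_subset_of_mem hs⟩
  have := hne.to_subtype
  have hcl : IsClosed {t | ‖a t‖ = ‖a‖} := isClosed_eq (by fun_prop) continuous_const
  obtain ⟨b, hb⟩ := IsCompact.nonempty_iInter_of_directed_nonempty_isCompact_isClosed
    (fun s : c => (s : Set K) ∩ {t | ‖a t‖ = ‖a‖})
    (by
      intro s t
      rcases hchain.total s.2 t.2 with h | h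
      · exact ⟨s, subset_rfl, Set.inter_subset_inter_left _ h⟩
      · exact ⟨t, Set.inter_subset_inter_left _ h, subset_rfl⟩)
    (fun s => by
      obtain ⟨b, hb, h⟩ := (hc s.2).exists_norm_eq a ha
      exact ⟨b, hb, h⟩)
    (fun s => ((hc s.2).isClosed.inter hcl).isCompact)
    (fun s => (hc s.2).isClosed.inter hcl)
  rw [Set.mem_iInter] at hb
  exact ⟨b, fun s hs => (hb ⟨s, hs⟩).1, (hb ⟨_, hne.some_mem⟩).2⟩

namespace IsNormAttainingSet

theorem norm_le (hB : IsNormAttainingSet A B) (a : A) {C : ℝ}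
    (h : ∀ t ∈ B, ‖(a : C(K, 𝕜)) t‖ ≤ C) : ‖a‖ ≤ C := by
  obtain ⟨b, hb, hab⟩ := hB.exists_norm_eq a a.2
  exact hab.symm.le.trans (h b hb)

/-- The restriction of `A` to a boundary is injective, and functions on a finite set form a
finite-dimensional space. -/
theorem infinite (hB : IsNormAttainingSet A B) (hdim : ¬ FiniteDimensional 𝕜 A) :
    B.Infinite := by
  intro hfin
  have := hfin.to_subtype
  let L : A →ₗ[𝕜] (B → 𝕜) :=
    { toFun := fun a b => (a : C(K, 𝕜)) b
      map_add' := fun _ _ => rfl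
      map_smul' := fun _ _ => rfl }
  refine hdim (FiniteDimensional.of_injective L ((injective_iff_map_eq_zero L).2 fun a ha => ?_))
  refine norm_le_zero_iff.1 (hB.norm_le a fun t ht => ?_)
  have : (a : C(K, 𝕜)) t = 0 := congrFun ha ⟨t, ht⟩
  simp [this]

/-! ### Peaking elements -/

/-- Minimality of the boundary `B` provides an element whose modulus is maximal only inside `U`;
a high power of its normalization is small on the rest of `B`. -/
theorem exists_peak (hB : Minimal (IsNormAttainingSet A) B) {U : Set K} (hU : IsOpen U)
    (hUB : (B ∩ U).Nonempty) {ε : ℝ} (hε : 0 < ε) :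
    ∃ h ∈ A, (∀ t, ‖h t‖ ≤ 1) ∧ (∀ t ∈ B \ U, ‖h t‖ ≤ ε) ∧ ∃ x ∈ B ∩ U, h x = 1 := by
  rcases (B \ U).eq_empty_or_nonempty with hemp | hne
  · obtain ⟨x, hx⟩ := hUB
    exact ⟨1, A.one_mem, by simp, by simp [hemp], x, hx, by simp⟩
  have hcl : IsClosed (B \ U) := hB.prop.isClosed.sdiff hU
  obtain ⟨a, ha, hlt⟩ : ∃ a ∈ A, ∀ b ∈ B \ U, ‖a b‖ ≠ ‖a‖ := by
    by_contra! hcon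
    obtain ⟨x, hxB, hxU⟩ := hUB
    exact (hB.le_of_le ⟨hcl, hcon⟩ Set.sdiff_subset hxB).2 hxU
  obtain ⟨x, hxB, hx⟩ := hB.prop.exists_norm_eq a ha
  have hxU : x ∈ U := by
    by_contra hxU
    exact hlt x ⟨hxB, hxU⟩ hx
  obtain ⟨b, hb, hmax⟩ := hcl.isCompact.exists_isMaxOn hne (f := fun t => ‖a t‖) (by fun_prop)
  have hb1 : ‖a b‖ < ‖a‖ := (a.norm_coe_le_norm b).lt_of_ne (hlt b hb)
  have hpos : 0 < ‖a‖ := (norm_nonneg _).trans_lt hb1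
  have hax : a x ≠ 0 := norm_pos_iff.1 (hx ▸ hpos)
  obtain ⟨n, hn⟩ := exists_pow_lt_of_lt_one hε ((div_lt_one hpos).2 hb1)
  have key : ∀ t, ‖(((a x)⁻¹ • a) ^ n) t‖ = (‖a t‖ / ‖a‖) ^ n := fun t => by
    simp [norm_mul, norm_inv, hx, div_eq_inv_mul]
  refine ⟨((a x)⁻¹ • a) ^ n, A.pow_mem (A.smul_mem ha _) n, fun t => ?_, fun t ht => ?_,
    x, ⟨hxB, hxU⟩, by simp [hax]⟩
  · rw [key]
    exact pow_le_one₀ (by positivity) ((div_le_one hpos).2 (a.norm_coe_le_norm t))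
  · rw [key]
    refine le_trans ?_ hn.le
    have : ‖a t‖ ≤ ‖a b‖ := hmax ht
    gcongr

/-- The sum of `m` successive peaks, each concentrated where the preceding ones are almost `1`.
At every point of `B` at most one summand is away from both `0` and `1`, so on `B` the sum of the
distances of `q t` to `0` and `m` exceeds `m` by little more than `2`, whatever `m` is. -/
theorem exists_sum_of_peaks (hB : Minimal (IsNormAttainingSet A) B) (m : ℕ) :
    ∀ {U : Set K}, IsOpen U → (B ∩ U).Nonempty → ∀ {η : ℝ}, 0 < η →
    ∃ q ∈ A, (∀ t ∈ B, ‖q t‖ + ‖(m : 𝕜) - q t‖ ≤ m + 2 + η) ∧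
      (∀ t ∈ B \ U, ‖q t‖ ≤ η) ∧ ∃ x ∈ B ∩ U, ‖(m : 𝕜) - q x‖ ≤ η := by
  induction m with
  | zero =>
    intro U _ hUB η hη
    obtain ⟨x, hx⟩ := hUB
    exact ⟨0, A.zero_mem, fun t _ => by simp; linarith, fun t _ => by simpa using hη.le, x, hx,
      by simpa using hη.le⟩
  | succ m ih =>
    intro U hU hUB η hη
    obtain ⟨h, hhA, hh1, hhU, x, hxU, hx⟩ := exists_peak hB hU hUB (half_pos hη)
    have hW : IsOpen (U ∩ {t | ‖1 - h t‖ < η / 2}) :=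
      hU.inter (isOpen_lt (by fun_prop) continuous_const)
    obtain ⟨q, hqA, hq1, hqW, y, hyW, hy⟩ :=
      ih hW ⟨x, hxU.1, hxU.2, by simpa [hx] using hη⟩ (half_pos hη)
    have hsub : ∀ t, ‖((m + 1 : ℕ) : 𝕜) - (h + q) t‖ ≤ ‖1 - h t‖ + ‖(m : 𝕜) - q t‖ := fun t => by
      refine le_trans (le_of_eq ?_) (norm_add_le _ _)
      congr 1
      rw [ContinuousMap.add_apply, Nat.cast_succ]
      ring
    have hadd : ∀ t, ‖(h + q) t‖ ≤ ‖h t‖ + ‖q t‖ := fun t => norm_add_le _ _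
    refine ⟨h + q, A.add_mem hhA hqA, fun t ht => ?_, fun t ht => ?_, y, ⟨hyW.1, hyW.2.1⟩, ?_⟩
    · have h1 := hsub t
      have h2 := hadd t
      have h3 := hh1 t
      rw [Nat.cast_succ (R := ℝ)]
      by_cases htW : t ∈ U ∩ {t | ‖1 - h t‖ < η / 2}
      · have h4 := hq1 t ht
        have h5 : ‖1 - h t‖ < η / 2 := htW.2
        linarith
      · have h4 := hqW t ⟨ht, htW⟩
        have h5 : ‖(m : 𝕜) - q t‖ ≤ m + ‖q t‖ := by
          simpa using norm_sub_le (m : 𝕜) (q t)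
        have h6 : ‖1 - h t‖ ≤ 1 + ‖h t‖ := by
          simpa using norm_sub_le (1 : 𝕜) (h t)
        linarith
    · have h1 := hadd t
      have h2 := hhU t ht
      have h3 := hqW t ⟨ht.1, fun h => ht.2 h.1⟩
      linarith
    · have h1 := hsub y
      have h2 : ‖1 - h y‖ < η / 2 := hyW.2.2
      linarith

/-- Peaking elements whose values lie in an arbitrarily thin ellipse with foci `0` and `1`. -/
theorem exists_thin_peak (hB : Minimal (IsNormAttainingSet A) B) {U : Set K} (hU : IsOpen U)
    (hUB : (B ∩ U).Nonempty) {δ η : ℝ} (hδ : 0 < δ) (hη : 0 < η) :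
    ∃ p : A, (∀ t ∈ B, ‖(p : C(K, 𝕜)) t‖ + ‖1 - (p : C(K, 𝕜)) t‖ ≤ 1 + δ) ∧
      (∀ t ∈ B \ U, ‖(p : C(K, 𝕜)) t‖ ≤ η) ∧ 1 - δ ≤ ‖p‖ := by
  obtain ⟨m, hm⟩ := exists_nat_gt (3 / δ)
  have hm0 : (0 : ℝ) < m := (by positivity : 0 < 3 / δ).trans hm
  have hmδ : 3 ≤ m * δ := ((div_lt_iff₀ hδ).1 hm).le
  have hm1 : (1 : ℝ) ≤ m := by exact_mod_cast (Nat.cast_pos.1 hm0)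
  have hmk : (m : 𝕜) ≠ 0 := by
    have : m ≠ 0 := by
      rintro rfl
      simp at hm0
    exact_mod_cast this
  obtain ⟨q, hqA, hq1, hqU, x, hx, hqx⟩ :=
    exists_sum_of_peaks hB m hU hUB (lt_min hη one_pos)
  have hp : ∀ t, ‖((m : 𝕜)⁻¹ • q) t‖ = ‖q t‖ / m := fun t => by
    simp [div_eq_inv_mul]
  have hp' : ∀ t, ‖1 - ((m : 𝕜)⁻¹ • q) t‖ = ‖(m : 𝕜) - q t‖ / m := fun t => by
    have : 1 - ((m : 𝕜)⁻¹ • q) t = (m : 𝕜)⁻¹ * ((m : 𝕜) - q t) := by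
      rw [mul_sub, inv_mul_cancel₀ hmk]
      rfl
    rw [this]
    simp [div_eq_inv_mul]
  refine ⟨⟨(m : 𝕜)⁻¹ • q, A.smul_mem hqA _⟩, fun t ht => ?_, fun t ht => ?_, ?_⟩
  · simp only [hp, hp']
    rw [← add_div, div_le_iff₀ hm0]
    have := hq1 t ht
    have := min_le_right η 1
    linarith
  · simp only [hp]
    exact (div_le_self (norm_nonneg _) hm1).trans ((hqU t ht).trans (min_le_left _ _))
  · have h1 : ‖((m : 𝕜)⁻¹ • q) x‖ ≤ ‖(m : 𝕜)⁻¹ • q‖ := ContinuousMap.norm_coe_le_norm _ x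
    have h2 : ‖1 - ((m : 𝕜)⁻¹ • q) x‖ ≤ δ := by
      rw [hp', div_le_iff₀ hm0]
      have := min_le_right η 1
      linarith
    have h3 : 1 - ‖((m : 𝕜)⁻¹ • q) x‖ ≤ ‖1 - ((m : 𝕜)⁻¹ • q) x‖ := by
      simpa using norm_sub_norm_le (1 : 𝕜) (((m : 𝕜)⁻¹ • q) x)
    change 1 - δ ≤ ‖(m : 𝕜)⁻¹ • q‖
    linarith

/-! ### Weakly null sequences of peaks -/

/-- If the sums `∑ ‖a j t‖` are uniformly bounded on the boundary, then `∑ a j` is weakly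
unconditionally Cauchy; in particular `a j` tends weakly to zero. -/
theorem tendsto_apply_zero (hB : IsNormAttainingSet A B) (f : A →L[𝕜] 𝕜) (a : ℕ → A) {C : ℝ}
    (hC : ∀ t ∈ B, ∀ N, ∑ j ∈ Finset.range N, ‖(a j : C(K, 𝕜)) t‖ ≤ C) :
    Tendsto (fun j => f (a j)) atTop (𝓝 0) := by
  -- Unimodular scalars turn the values of `f` into their moduli.
  have hσ : ∀ z : 𝕜, ∃ σ : 𝕜, ‖σ‖ ≤ 1 ∧ σ * z = ((‖z‖ : ℝ) : 𝕜) := fun z => by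
    rcases eq_or_ne z 0 with rfl | hz
    · exact ⟨0, by simp, by simp⟩
    · refine ⟨(‖z‖ : 𝕜) / z, ?_, by field_simp⟩
      rw [norm_div, RCLike.norm_ofReal, abs_norm, div_self (norm_ne_zero_iff.2 hz)]
  choose σ hσ1 hσ2 using hσ
  have hsum : ∀ N, ∑ j ∈ Finset.range N, ‖f (a j)‖ ≤ ‖f‖ * C := fun N => by
    have h1 : f (∑ j ∈ Finset.range N, σ (f (a j)) • a j)
        = ((∑ j ∈ Finset.range N, ‖f (a j)‖ : ℝ) : 𝕜) := by
      simp [map_sum, hσ2]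
    have h2 : ‖∑ j ∈ Finset.range N, σ (f (a j)) • a j‖ ≤ C := by
      refine hB.norm_le _ fun t ht => le_trans ?_ (hC t ht N)
      have h3 : ((∑ j ∈ Finset.range N, σ (f (a j)) • a j : A) : C(K, 𝕜)) t
          = ∑ j ∈ Finset.range N, σ (f (a j)) * (a j : C(K, 𝕜)) t := by
        simp
      rw [h3]
      refine (norm_sum_le _ _).trans (Finset.sum_le_sum fun j _ => ?_)
      rw [norm_mul]
      exact mul_le_of_le_one_left (norm_nonneg _) (hσ1 _)
    calc ∑ j ∈ Finset.range N, ‖f (a j)‖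
        = ‖f (∑ j ∈ Finset.range N, σ (f (a j)) • a j)‖ := by
          rw [h1, RCLike.norm_ofReal, abs_of_nonneg (Finset.sum_nonneg fun _ _ => norm_nonneg _)]
      _ ≤ ‖f‖ * C := f.le_opNorm_of_le h2
  have := (summable_of_sum_range_le (fun _ => norm_nonneg _) hsum).tendsto_atTop_zero
  exact tendsto_zero_iff_norm_tendsto_zero.2 this

/-- Thin peaks over disjoint relatively open subsets of an infinite minimal boundary. -/
theorem exists_seq_thin_peak [T2Space K] (hB : Minimal (IsNormAttainingSet A) B)
    (hinf : B.Infinite) {δ : ℝ} (hδ : 0 < δ) :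
    ∃ p : ℕ → A, (∀ j, ∀ t ∈ B, ‖(p j : C(K, 𝕜)) t‖ + ‖1 - (p j : C(K, 𝕜)) t‖ ≤ 1 + δ) ∧
      (∀ j, 1 - δ ≤ ‖p j‖) ∧
      ∀ t ∈ B, ∀ N, ∑ j ∈ Finset.range N, ‖(p j : C(K, 𝕜)) t‖ ≤ 1 + δ + 2 := by
  classical
  have := hinf.to_subtype
  obtain ⟨V, hVinf, hVo, hVd⟩ := exists_seq_infinite_isOpen_pairwise_disjoint B
  choose U hUo hUV using fun j => isOpen_induced_iff.1 (hVo j)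
  have hUB : ∀ j, (B ∩ U j).Nonempty := fun j => by
    obtain ⟨x, hx⟩ := (hVinf j).nonempty
    rw [← hUV j] at hx
    exact ⟨x, x.2, hx⟩
  choose p hp1 hpU hpn using fun j =>
    exists_thin_peak hB (hUo j) (hUB j) hδ (η := (1 / 2 : ℝ) ^ j) (by positivity)
  refine ⟨p, hp1, hpn, fun t ht N => ?_⟩
  have hle : ∀ j, ‖(p j : C(K, 𝕜)) t‖ ≤ 1 + δ := fun j =>
    (le_add_of_nonneg_right (norm_nonneg _)).trans (hp1 j t ht)
  -- The point `t` lies in at most one of the sets `U j`.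
  have huniq : ∀ i j, t ∈ U i → t ∈ U j → i = j := fun i j hi hj => by
    by_contra hij
    have hi' : (⟨t, ht⟩ : B) ∈ V i := by
      rw [← hUV i]
      exact hi
    have hj' : (⟨t, ht⟩ : B) ∈ V j := by
      rw [← hUV j]
      exact hj
    exact Set.disjoint_left.1 (hVd hij) hi' hj'
  have hbound : ∀ j, ‖(p j : C(K, 𝕜)) t‖ ≤ (if t ∈ U j then 1 + δ else 0) + (1 / 2 : ℝ) ^ j :=
    fun j => by
      split_ifs with h
      · exact (hle j).trans (le_add_of_nonneg_right (by positivity))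
      · simpa using hpU j t ⟨ht, h⟩
  refine (Finset.sum_le_sum fun j _ => hbound j).trans ?_
  rw [Finset.sum_add_distrib]
  refine add_le_add ?_ (sum_geometric_two_le N)
  rw [← Finset.sum_filter, Finset.sum_const, nsmul_eq_mul]
  have hcard : ((Finset.range N).filter fun j => t ∈ U j).card ≤ 1 :=
    Finset.card_le_one.2 fun i hi j hj =>
      huniq i j (Finset.mem_filter.1 hi).2 (Finset.mem_filter.1 hj).2
  exact mul_le_of_le_one_left (by linarith) (by exact_mod_cast hcard)

end IsNormAttainingSet

end NormAttaining

/-! ### Slices -/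

theorem unitBallSlice_nonempty {𝕜 : Type*} [RCLike 𝕜] {X : Type*} [NormedAddCommGroup X]
    [NormedSpace 𝕜 X] {f : X →L[𝕜] 𝕜} (hf : ‖f‖ = 1) {ε : ℝ} (hε : 0 < ε) :
    (unitBallSlice f ε).Nonempty := by
  obtain ⟨x, hx, hfx⟩ := f.exists_lt_apply_of_lt_opNorm (r := max (1 - ε) 0)
    (by rw [hf]; exact max_lt (by linarith) one_pos)
  have hpos : 0 < ‖f x‖ := (le_max_right _ _).trans_lt hfx
  have hne : f x ≠ 0 := norm_pos_iff.1 hpos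
  refine ⟨((‖f x‖ : 𝕜) / f x) • x, And.intro ?_ ?_⟩
  · rw [norm_smul, norm_div, RCLike.norm_ofReal, abs_norm, div_self hpos.ne', one_mul]
    exact hx.le
  · rw [map_smul, smul_eq_mul, div_mul_cancel₀ _ hne, RCLike.ofReal_re]
    exact (le_max_left _ _).trans_lt hfx

theorem norm_le_one_of_mem_weightedSetSum {𝕜 : Type*} [RCLike 𝕜] {X : Type*}
    [NormedAddCommGroup X] [NormedSpace 𝕜 X] {n : ℕ} {c : Fin n → ℝ} {S : Fin n → Set X}
    (hc : ∀ i, 0 ≤ c i) (hc1 : ∑ i, c i = 1) (hS : ∀ i, ∀ x ∈ S i, ‖x‖ ≤ 1) {y : X}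
    (hy : y ∈ weightedSetSum 𝕜 c S) : ‖y‖ ≤ 1 := by
  obtain ⟨x, hx, rfl⟩ := hy
  rw [← hc1]
  refine (norm_sum_le _ _).trans (Finset.sum_le_sum fun i _ => ?_)
  rw [norm_smul, RCLike.norm_ofReal, abs_of_nonneg (hc i)]
  exact mul_le_of_le_one_right (hc i) (hS i _ (hx i))

theorem theorem4p2 {𝕜 : Type*} [RCLike 𝕜] {K : Type*} [TopologicalSpace K] [CompactSpace K]
    [T2Space K] (A : Subalgebra 𝕜 C(K, 𝕜)) (hA : IsUniformAlgebra A)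
    (hdim : ¬ FiniteDimensional 𝕜 A) :
    HasStrongDiameterTwoProperty 𝕜 A := by
  intro n c f ε hc hc1 hf hε
  have : Nonempty K := by
    by_contra hK
    rw [not_nonempty_iff] at hK
    have : Subsingleton A := ⟨fun a b => Subtype.ext (ContinuousMap.ext fun t => hK.elim t)⟩
    exact hdim inferInstance
  obtain ⟨B, hB⟩ := exists_minimal_isNormAttainingSet A
  have hnorm : ∀ y ∈ weightedSetSum 𝕜 c fun i => unitBallSlice (f i) (ε i), ‖y‖ ≤ 1 :=
    fun y => norm_le_one_of_mem_weightedSetSum hc hc1 fun i x hx => hx.1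
  refine le_antisymm (Metric.diam_le_of_forall_dist_le zero_le_two fun y hy z hz => ?_) ?_
  · rw [dist_eq_norm]
    linarith [norm_sub_le y z, hnorm y hy, hnorm z hz]
  have hbdd : Bornology.IsBounded (weightedSetSum 𝕜 c fun i => unitBallSlice (f i) (ε i)) :=
    isBounded_iff_forall_norm_le.2 ⟨1, hnorm⟩
  choose x hx1 hxf using fun i => unitBallSlice_nonempty (hf i) (hε i)
  refine le_of_forall_lt fun r hr => ?_
  -- `δ` is so small that shrinking by `1 + δ` keeps every `x i` in its slice.
  obtain ⟨δ, ⟨hδx, hδr⟩, hδ⟩ : ∃ δ : ℝ, ((∀ i, 1 - ε i < (1 + δ)⁻¹ * RCLike.re (f i (x i))) ∧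
      r < (1 + δ)⁻¹ * (2 * (1 - δ))) ∧ 0 < δ := by
    have hlim : ∀ s : ℝ, Tendsto (fun δ : ℝ => (1 + δ)⁻¹ * (s * (1 - δ))) (𝓝[>] 0) (𝓝 s) := by
      intro s
      have : ContinuousAt (fun δ : ℝ => (1 + δ)⁻¹ * (s * (1 - δ))) 0 := by
        refine ContinuousAt.mul (ContinuousAt.inv₀ (by fun_prop) (by norm_num)) (by fun_prop)
      simpa using this.tendsto.mono_left nhdsWithin_le_nhds
    have hlim' : ∀ s : ℝ, Tendsto (fun δ : ℝ => (1 + δ)⁻¹ * s) (𝓝[>] 0) (𝓝 s) := by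
      intro s
      have : ContinuousAt (fun δ : ℝ => (1 + δ)⁻¹ * s) 0 := by
        refine ContinuousAt.mul (ContinuousAt.inv₀ (by fun_prop) (by norm_num)) (by fun_prop)
      simpa using this.tendsto.mono_left nhdsWithin_le_nhds
    exact (((eventually_all.2 fun i => (hlim' _).eventually_const_lt (hxf i)).and
      ((hlim 2).eventually_const_lt hr)).and self_mem_nhdsWithin).exists
  obtain ⟨p, hp1, hpn, hpsum⟩ :=
    IsNormAttainingSet.exists_seq_thin_peak hB (hB.prop.infinite hdim) hδ
  have hδ1 : 0 < 1 + δ := by linarith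
  have hxt : ∀ i t, ‖(x i : C(K, 𝕜)) t‖ ≤ 1 := fun i t =>
    ((x i : C(K, 𝕜)).norm_coe_le_norm t).trans (hx1 i)
  have hp0 : ∀ i, Tendsto (fun j => f i (p j)) atTop (𝓝 0) := fun i =>
    hB.prop.tendsto_apply_zero (f i) p hpsum
  have hxp0 : ∀ i, Tendsto (fun j => f i (x i * p j)) atTop (𝓝 0) := fun i =>
    hB.prop.tendsto_apply_zero (f i) (fun j => x i * p j) fun t ht N =>
      (Finset.sum_le_sum fun j _ => by
        simpa using mul_le_of_le_one_left (norm_nonneg ((p j : C(K, 𝕜)) t)) (hxt i t)).trans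
        (hpsum t ht N)
  let y (σ : 𝕜) (j : ℕ) (i : Fin n) : A :=
    (((1 + δ)⁻¹ : ℝ) : 𝕜) • (x i - x i * p j + σ • p j)
  have hy1 : ∀ σ : 𝕜, ‖σ‖ = 1 → ∀ j i, ‖y σ j i‖ ≤ 1 := fun σ hσ j i => by
    rw [norm_smul, RCLike.norm_ofReal, abs_of_pos (inv_pos.2 hδ1), inv_mul_le_one₀ hδ1]
    refine hB.prop.norm_le _ fun t ht => le_trans ?_ (hp1 j t ht)
    have h1 : ((x i - x i * p j + σ • p j : A) : C(K, 𝕜)) t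
        = σ * (p j : C(K, 𝕜)) t + (x i : C(K, 𝕜)) t * (1 - (p j : C(K, 𝕜)) t) := by
      simp
      ring
    rw [h1]
    refine (norm_add_le _ _).trans (add_le_add ?_ ?_)
    · rw [norm_mul, hσ, one_mul]
    · rw [norm_mul]
      exact mul_le_of_le_one_left (norm_nonneg _) (hxt i t)
  have hyf : ∀ σ : 𝕜, ∀ᶠ j in atTop, ∀ i, 1 - ε i < RCLike.re (f i (y σ j i)) := fun σ => by
    refine eventually_all.2 fun i => ?_
    have h1 : Tendsto (fun j => f i (y σ j i)) atTop
        (𝓝 ((((1 + δ)⁻¹ : ℝ) : 𝕜) * (f i (x i) - 0 + σ * 0))) := by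
      simp only [y, map_smul, map_add, map_sub, smul_eq_mul]
      exact (((tendsto_const_nhds.sub (hxp0 i)).add ((hp0 i).const_mul σ))).const_mul _
    have h2 := (RCLike.continuous_re.tendsto _).comp h1
    refine h2.eventually_const_lt ?_
    rw [sub_zero, mul_zero, add_zero, RCLike.re_ofReal_mul]
    exact hδx i
  obtain ⟨j, hj1, hj2⟩ := ((hyf 1).and (hyf (-1))).exists
  have hmem := Metric.dist_le_diam_of_mem hbdd
    (⟨y 1 j, fun i => ⟨hy1 1 (by simp) j i, hj1 i⟩, rfl⟩ :
      ∑ i, (c i : 𝕜) • y 1 j i ∈ weightedSetSum 𝕜 c fun i => unitBallSlice (f i) (ε i))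
    (⟨y (-1) j, fun i => ⟨hy1 (-1) (by simp) j i, hj2 i⟩, rfl⟩ :
      ∑ i, (c i : 𝕜) • y (-1) j i ∈ weightedSetSum 𝕜 c fun i => unitBallSlice (f i) (ε i))
  refine lt_of_lt_of_le ?_ hmem
  have hdiff : ∀ i, y 1 j i - y (-1) j i = (((1 + δ)⁻¹ * 2 : ℝ) : 𝕜) • p j := fun i => by
    simp only [y]
    push_cast
    module
  have hcsum : ∑ i, (c i : 𝕜) = 1 := by
    exact_mod_cast congrArg (RCLike.ofReal (K := 𝕜)) hc1
  rw [dist_eq_norm, ← Finset.sum_sub_distrib]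
  simp only [← smul_sub, hdiff]
  rw [← Finset.sum_smul, hcsum, one_smul, norm_smul, RCLike.norm_ofReal,
    abs_of_pos (by positivity), mul_assoc]
  refine hδr.trans_le ?_
  have := hpn j
  gcongr
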